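/- Let $P \subset \mathbb{R}^3$ be a $3$-dimensional convex polytope that is simple (every vertex lies on exactly three facets) and $3$-colorable (its facets can be colored with three colors so that any two distinct facets that meet have different colors). For a facet $F$ of $P$ let $\xi_F \in \mathbb{F}_2^{V(P)}$ be the vector, indexed by the set $V(P)$ of vertices of $P$, whose coordinate at $v$ is $1$ if $v \in F$ and $0$ otherwise, and let $\mathfrak{B}_1(P) = \mathrm{Span}_{\mathbb{F}_2}\{\xi_F : F \text{ a facet of } P\} \subseteq \mathbb{F}_2^{V(P)}$. Then the code $\mathfrak{B}_1(P)$ is self-dual with respect to the standard bilinear form, and its minimum distance (the least Hamming distance between two distinct codewords) is exactly $4$. Moreover, $P$ has a facet $F$ with exactly four vertices, and $\xi_F$ is then a codeword of weight $4$. -/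

import Mathlib

/-- An `n`-dimensional convex polytope in `ℝⁿ`: the convex hull of finitely many points whose
affine dimension is `n`. -/
structure Polytope (n : ℕ) where
  /-- the underlying set of points -/
  carrier : Set (EuclideanSpace ℝ (Fin n))
  exists_finset : ∃ s : Finset (EuclideanSpace ℝ (Fin n)),
    carrier = convexHull ℝ (s : Set (EuclideanSpace ℝ (Fin n)))
  nonempty : carrier.Nonempty
  dim_eq : Module.finrank ℝ (vectorSpan ℝ carrier) = n

namespace Polytope

variable {n : ℕ} (P : Polytope n)

/-- The type of vertices (extreme points) of a polytope. -/
def Vertex : Type := {x : EuclideanSpace ℝ (Fin n) // x ∈ Set.extremePoints ℝ P.carrier}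

instance : Finite P.Vertex := by
  obtain ⟨s, hs⟩ := P.exists_finset
  refine Set.Finite.to_subtype (s.finite_toSet.subset ?_)
  rw [hs]
  exact extremePoints_convexHull_subset

noncomputable instance : Fintype P.Vertex := Fintype.ofFinite _

/-- `P.IsFace k F`: the set `F` is a (nonempty) face of `P` of codimension `k`, that is, `F` is the
set of points of `P` where some linear functional attains its maximum over `P`, and its affine
dimension is `n - k`. The zero functional gives the face `P` itself. -/
def IsFace (k : ℕ) (F : Set (EuclideanSpace ℝ (Fin n))) : Prop :=
  F.Nonempty ∧ IsExposed ℝ P.carrier F ∧ Module.finrank ℝ (vectorSpan ℝ F) + k = n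

/-- Facets are the faces of codimension one. -/
def Facet : Type := {F : Set (EuclideanSpace ℝ (Fin n)) // P.IsFace 1 F}

/-- An `n`-polytope is simple if every vertex lies on exactly `n` facets. -/
def IsSimple : Prop :=
  ∀ v : P.Vertex, {F : Set (EuclideanSpace ℝ (Fin n)) | P.IsFace 1 F ∧ v.1 ∈ F}.ncard = n

/-- The facets can be colored by `m` colors so that distinct facets that meet have different
colors. -/
def IsColorable (m : ℕ) : Prop :=
  ∃ c : P.Facet → Fin m, ∀ F G : P.Facet, F ≠ G → (F.1 ∩ G.1).Nonempty → c F ≠ c G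

/-- The incidence vector `ξ_F` over `𝔽₂` of a face `F`: its coordinate at the vertex `v` is `1` if
`v ∈ F` and `0` otherwise. -/
noncomputable def faceVector (F : Set (EuclideanSpace ℝ (Fin n))) : P.Vertex → ZMod 2 :=
  fun v => Set.indicator F (fun _ => 1) v.1

/-- The codimension-`k` face code: the span over `𝔽₂` of the incidence vectors of all faces of
codimension `k`. -/
noncomputable def faceCode (k : ℕ) : Submodule (ZMod 2) (P.Vertex → ZMod 2) :=
  Submodule.span (ZMod 2) {u | ∃ F, P.IsFace k F ∧ u = P.faceVector F}

end Polytope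

/-- The dual code `C^⊥` with respect to the standard bilinear form. -/
def dualCode {ι : Type*} [Fintype ι] (C : Submodule (ZMod 2) (ι → ZMod 2)) :
    Submodule (ZMod 2) (ι → ZMod 2) where
  carrier := {u | ∀ c ∈ C, u ⬝ᵥ c = 0}
  zero_mem' := fun c _ => zero_dotProduct c
  add_mem' := fun {u v} hu hv c hc => by
    rw [add_dotProduct, hu c hc, hv c hc, add_zero]
  smul_mem' := fun a u hu c hc => by
    rw [smul_dotProduct, hu c hc, smul_zero]

/-- A binary code is self-dual if it equals its dual code. -/
def IsSelfDualCode {ι : Type*} [Fintype ι] (C : Submodule (ZMod 2) (ι → ZMod 2)) : Prop :=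
  C = dualCode C

/-- `d` is the minimum distance of `C`: the least Hamming distance of two distinct codewords
(in particular, it is attained). -/
def HasMinDist {ι : Type*} [Fintype ι] (C : Submodule (ZMod 2) (ι → ZMod 2)) (d : ℕ) : Prop :=
  IsLeast {e : ℕ | ∃ u ∈ C, ∃ v ∈ C, u ≠ v ∧ e = hammingDist u v} d

/-! ### Facet half-space description of a polytope -/

namespace Polytope

variable {n : ℕ} (P : Polytope n)

/-! Two distinct facets share 0 or 2 vertices (`IsSimple.exists_neighbor`), and the coloring makes
every facet even (`IsSimple.even_card`), so the code is self-orthogonal.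

The dimension comes from a sweep by a linear functional `ℓ` injective on vertices. Let `T±` be the
vertices that are maxima of `±ℓ` on some facet. A dual word vanishing off `T±` is zero: test it on a
facet whose top is the lowest vertex of its support. Hence the dual has dimension at most `|V| -
|T±|`. Two of the three edge slopes at a vertex agree in sign, so `T+ ∪ T- = V`; adding the two
bounds, twice the dual dimension is at most `|V|`.

The sweep also replaces Euler's formula: `|T±| < #facets` gives `|V| < 2 #facets`, which is
incompatible with all facets having at least 6 vertices. Weights are even by self-orthogonality, and
weight 2 fails because some facet separates any two vertices. -/

theorem isCompact : IsCompact P.carrier := by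
  obtain ⟨s, hs⟩ := P.exists_finset
  rw [hs]
  exact s.finite_toSet.isCompact_convexHull ℝ

theorem convex : Convex ℝ P.carrier := by
  obtain ⟨s, hs⟩ := P.exists_finset
  rw [hs]
  exact convex_convexHull ℝ _

theorem interior_nonempty : (interior P.carrier).Nonempty := by
  rw [P.convex.interior_nonempty_iff_affineSpan_eq_top,
    ← AffineSubspace.direction_eq_top_iff_of_nonempty (P.nonempty.affineSpan ℝ),
    direction_affineSpan]
  apply Submodule.eq_top_of_finrank_eq
  rw [P.dim_eq, finrank_euclideanSpace_fin]

/-- An exposed subset of a polytope is the convex hull of the generating points it contains. -/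
theorem subset_convexHull_of_isExposed {s : Finset (EuclideanSpace ℝ (Fin n))}
    (hs : P.carrier = convexHull ℝ (s : Set (EuclideanSpace ℝ (Fin n))))
    {F : Set (EuclideanSpace ℝ (Fin n))} (hF : IsExposed ℝ P.carrier F) :
    F ⊆ convexHull ℝ (s ∩ F) := by
  have hsub : F.extremePoints ℝ ⊆ s ∩ F := by
    rw [hF.isExtreme.extremePoints_eq]
    rintro x ⟨hx, hxP⟩
    rw [hs] at hxP
    exact ⟨extremePoints_convexHull_subset hxP, hx⟩
  rw [← closure_convexHull_extremePoints (hF.isCompact P.isCompact) (hF.convex P.convex)]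
  refine closure_minimal ?_ ?_
  · rw [closure_convexHull_extremePoints (hF.isCompact P.isCompact) (hF.convex P.convex)]
    exact convexHull_mono hsub
  · rw [closure_convexHull_extremePoints (hF.isCompact P.isCompact) (hF.convex P.convex)]
    exact ((s.finite_toSet.inter_of_left F).isCompact_convexHull ℝ).isClosed

/-- The last point of a convex body on a segment from an interior point to an exterior point. -/
theorem exists_frontier_point {x y : EuclideanSpace ℝ (Fin n)} (hx : x ∈ interior P.carrier)
    (hy : y ∉ P.carrier) :
    ∃ t : ℝ, 0 < t ∧ t < 1 ∧ AffineMap.lineMap x y t ∈ P.carrier ∧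
      AffineMap.lineMap x y t ∉ interior P.carrier := by
  have hcont : Continuous (AffineMap.lineMap x y : ℝ → EuclideanSpace ℝ (Fin n)) :=
    AffineMap.lineMap_continuous
  obtain ⟨t, ⟨⟨ht0, ht1⟩, htP⟩, hmax⟩ :=
    (isCompact_Icc.inter_right (P.isCompact.isClosed.preimage hcont)).exists_isGreatest
      (s := Set.Icc (0 : ℝ) 1 ∩ AffineMap.lineMap x y ⁻¹' P.carrier)
      ⟨0, by simp, by simpa using interior_subset hx⟩
  have htP : AffineMap.lineMap x y t ∈ P.carrier := htP
  have ht1' : t < 1 := lt_of_le_of_ne ht1 fun h => hy (by simpa [h] using htP)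
  have hint : AffineMap.lineMap x y t ∉ interior P.carrier := by
    intro hin
    have h1 : ∀ᶠ r in nhdsWithin t (Set.Ioi t), AffineMap.lineMap x y r ∈ interior P.carrier :=
      (hcont.continuousAt.eventually (isOpen_interior.mem_nhds hin)).filter_mono
        nhdsWithin_le_nhds
    have h2 : ∀ᶠ r in nhdsWithin t (Set.Ioi t), r ∈ Set.Ioo t 1 := Ioo_mem_nhdsGT ht1'
    obtain ⟨r, hr1, hr2⟩ := (h1.and h2).exists
    exact absurd (hmax ⟨⟨ht0.trans hr2.1.le, hr2.2.le⟩,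
      show _ ∈ P.carrier from interior_subset hr1⟩) (not_le.2 hr2.1)
  refine ⟨t, lt_of_le_of_ne ht0 ?_, ht1', htP, hint⟩
  rintro rfl
  exact hint (by simpa using hx)

/-- Proper affine subspaces are null sets, while the interior has positive measure. This supplies a
base point in general position. -/
theorem exists_mem_interior_forall_notMem
    (S : Set (AffineSubspace ℝ (EuclideanSpace ℝ (Fin n)))) (hS : S.Finite)
    (htop : ∀ A ∈ S, A ≠ ⊤) : ∃ x ∈ interior P.carrier, ∀ A ∈ S, x ∉ A := by
  have hnull : MeasureTheory.volume (⋃ A ∈ S, (A : Set (EuclideanSpace ℝ (Fin n)))) = 0 :=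
    (MeasureTheory.measure_biUnion_null_iff hS.countable).2 fun A hA =>
      MeasureTheory.Measure.addHaar_affineSubspace _ A (htop A hA)
  have hpos : MeasureTheory.volume (interior P.carrier) ≠ 0 :=
    (isOpen_interior.measure_pos _ P.interior_nonempty).ne'
  by_contra! hcon
  refine hpos (MeasureTheory.measure_mono_null (fun x hx => ?_) hnull)
  obtain ⟨A, hA, hxA⟩ := hcon x hx
  exact Set.mem_biUnion hA hxA

/-- A point outside a polytope is separated from it by a facet. -/
theorem exists_facet_of_notMem {y : EuclideanSpace ℝ (Fin n)} (hy : y ∉ P.carrier) :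
    ∃ F, P.IsFace 1 F ∧ ∃ x ∈ P.carrier, x ∉ F ∧ ∃ t : ℝ, 0 < t ∧ t < 1 ∧
      AffineMap.lineMap x y t ∈ F := by
  classical
  obtain ⟨s, hs⟩ := P.exists_finset
  -- Avoid every flat through `y` and generators of affine dimension at most `n - 2`; adjoining `y`
  -- raises the dimension by at most one, so these flats are proper.
  obtain ⟨x, hx, hgen⟩ := P.exists_mem_interior_forall_notMem
    ((fun t : Finset (EuclideanSpace ℝ (Fin n)) =>
      affineSpan ℝ (insert y (t : Set (EuclideanSpace ℝ (Fin n))))) ''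
      {t | t ∈ s.powerset ∧
        Module.finrank ℝ (vectorSpan ℝ (t : Set (EuclideanSpace ℝ (Fin n)))) + 1 < n})
    ((s.powerset.finite_toSet.subset fun t ht => ht.1).image _) (by
      rintro _ ⟨t, ht, rfl⟩ htop
      have htop : affineSpan ℝ (insert y (t : Set (EuclideanSpace ℝ (Fin n)))) = ⊤ := htop
      have h1 := finrank_vectorSpan_insert_le_set ℝ (t : Set (EuclideanSpace ℝ (Fin n))) y
      rw [← direction_affineSpan, htop, AffineSubspace.direction_top, finrank_top,
        finrank_euclideanSpace_fin] at h1
      exact absurd ht.2 (not_lt.2 h1))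
  obtain ⟨t, ht0, ht1, hzP, hzint⟩ := P.exists_frontier_point hx hy
  set z := AffineMap.lineMap x y t with hz
  obtain ⟨f, hf⟩ := geometric_hahn_banach_open_point P.convex.interior isOpen_interior hzint
  have hfP : ∀ a ∈ P.carrier, f a ≤ f z := by
    intro a ha
    have hcl : a ∈ closure (interior P.carrier) := by
      rw [P.convex.closure_interior_eq_closure_of_nonempty_interior P.interior_nonempty]
      exact subset_closure ha
    exact closure_minimal (t := {a | f a ≤ f z}) (fun b hb => (hf b hb).le)
      (isClosed_le f.continuous continuous_const) hcl
  set F : Set (EuclideanSpace ℝ (Fin n)) := {a | a ∈ P.carrier ∧ ∀ b ∈ P.carrier, f b ≤ f a}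
  have hzF : z ∈ F := ⟨hzP, hfP⟩
  have hexp : IsExposed ℝ P.carrier F := fun _ => ⟨f, rfl⟩
  have hxF : x ∉ F := fun h => absurd (h.2 z hzP) (not_le.2 (hf x hx))
  have hub : Module.finrank ℝ (vectorSpan ℝ F) < n := by
    have hne : vectorSpan ℝ F ≠ ⊤ := by
      intro htop
      have hker : vectorSpan ℝ F ≤ LinearMap.ker (f : EuclideanSpace ℝ (Fin n) →ₗ[ℝ] ℝ) := by
        rw [vectorSpan_def, Submodule.span_le]
        rintro _ ⟨a, ha, b, hb, rfl⟩
        have := le_antisymm (ha.2 b hb.1) (hb.2 a ha.1)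
        simp [this]
      have hm : z - x ∈ vectorSpan ℝ F := htop ▸ Submodule.mem_top
      have := hker hm
      have h0 : f (z - x) = 0 := this
      rw [map_sub] at h0
      linarith [hf x hx]
    simpa using Submodule.finrank_lt hne
  refine ⟨F, ⟨⟨z, hzF⟩, hexp, ?_⟩, x, interior_subset hx, hxF, t, ht0, ht1, hzF⟩
  -- If `F` had dimension below `n - 1`, its generators together with `y` would span an avoided
  -- flat; this flat contains `y` and `z`, hence `x` on their line.
  by_contra hdim
  have hcoe : ((s.filter (· ∈ F) : Finset _) : Set (EuclideanSpace ℝ (Fin n))) = ↑s ∩ F := by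
    ext a; simp
  refine hgen _ ⟨s.filter (· ∈ F), ⟨by simp, ?_⟩, rfl⟩ ?_
  · refine lt_of_le_of_lt (Nat.add_le_add_right (Submodule.finrank_mono
      (vectorSpan_mono ℝ (s₂ := F) ?_)) 1) (lt_of_le_of_ne hub hdim)
    rw [hcoe]; exact Set.inter_subset_right
  · change x ∈ affineSpan ℝ (insert y _)
    rw [hcoe]
    have hzA : z ∈ affineSpan ℝ (insert y (↑s ∩ F)) :=
      affineSpan_mono ℝ (Set.subset_insert _ _)
        (convexHull_subset_affineSpan _ (P.subset_convexHull_of_isExposed hs hexp hzF))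
    have hyA : y ∈ affineSpan ℝ (insert y (↑s ∩ F)) :=
      subset_affineSpan ℝ _ (Set.mem_insert _ _)
    have hxe : x = AffineMap.lineMap y z (1 / (1 - t)) := by
      have h1 : (1 - t) ≠ 0 := by linarith
      rw [hz, AffineMap.lineMap_apply_module', AffineMap.lineMap_apply_module']
      have : t • (y - x) + x - y = (1 - t) • (x - y) := by module
      rw [this, smul_smul, one_div_mul_cancel h1]
      module
    rw [hxe]
    exact AffineMap.lineMap_mem _ hyA hzA

/-- A facet is the convex hull of the generators it contains, so it is determined by a subset of
`s`. -/
instance : Finite P.Facet := by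
  obtain ⟨s, hs⟩ := P.exists_finset
  have hfin : (Set.powerset (s : Set (EuclideanSpace ℝ (Fin n)))).Finite :=
    s.finite_toSet.finite_subsets
  have : Finite (Set.powerset (s : Set (EuclideanSpace ℝ (Fin n)))) := hfin.to_subtype
  refine Finite.of_injective
    (fun F : P.Facet => (⟨↑s ∩ F.1, Set.inter_subset_left⟩ :
      Set.powerset (s : Set (EuclideanSpace ℝ (Fin n))))) fun F G h => ?_
  have heq : ↑s ∩ F.1 = ↑s ∩ G.1 := congrArg Subtype.val h
  have hle : ∀ F : P.Facet, F.1 = convexHull ℝ (↑s ∩ F.1) := fun F =>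
    (P.subset_convexHull_of_isExposed hs F.2.2.1).antisymm
      (convexHull_min Set.inter_subset_right (F.2.2.1.convex P.convex))
  exact Subtype.ext (by rw [hle F, hle G, heq])

noncomputable instance : Fintype P.Facet := Fintype.ofFinite _

theorem exists_facet_functional (F : P.Facet) :
    ∃ l : EuclideanSpace ℝ (Fin n) →L[ℝ] ℝ, ∃ c : ℝ,
      (∀ x ∈ P.carrier, l x ≤ c) ∧ ∀ x ∈ P.carrier, x ∈ F.1 ↔ l x = c := by
  obtain ⟨z, hz⟩ := F.2.1
  obtain ⟨l, hl⟩ := F.2.2.1 F.2.1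
  have hz' := hl ▸ hz
  refine ⟨l, l z, hz'.2, fun x hx => ⟨fun hxF => ?_, fun h => ?_⟩⟩
  · rw [hl] at hxF
    exact le_antisymm (hz'.2 x hx) (hxF.2 z hz'.1)
  · rw [hl]
    exact ⟨hx, fun y hy => h ▸ hz'.2 y hy⟩

/-- A linear functional whose maximum over the polytope is attained exactly on the facet. -/
noncomputable def facetNormal (F : P.Facet) : EuclideanSpace ℝ (Fin n) →L[ℝ] ℝ :=
  (P.exists_facet_functional F).choose

/-- The maximum of `facetNormal` over the polytope. -/
noncomputable def facetHeight (F : P.Facet) : ℝ :=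
  (P.exists_facet_functional F).choose_spec.choose

theorem facetNormal_le (F : P.Facet) {x} (hx : x ∈ P.carrier) :
    P.facetNormal F x ≤ P.facetHeight F :=
  (P.exists_facet_functional F).choose_spec.choose_spec.1 x hx

theorem mem_facet_iff (F : P.Facet) {x} (hx : x ∈ P.carrier) :
    x ∈ F.1 ↔ P.facetNormal F x = P.facetHeight F :=
  (P.exists_facet_functional F).choose_spec.choose_spec.2 x hx

variable {P} in
theorem Facet.subset (F : P.Facet) : F.1 ⊆ P.carrier := F.2.2.1.isExtreme.subset

/-- A polytope is the intersection of its facet half-spaces. -/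
theorem mem_of_forall_facetNormal_le {y} (h : ∀ F, P.facetNormal F y ≤ P.facetHeight F) :
    y ∈ P.carrier := by
  by_contra hy
  obtain ⟨F, hF, x, hx, hxF, t, ht0, ht1, hz⟩ := P.exists_facet_of_notMem hy
  have h1 := (P.mem_facet_iff ⟨F, hF⟩ (Facet.subset ⟨F, hF⟩ hz)).1 hz
  have h2 := lt_of_le_of_ne (P.facetNormal_le ⟨F, hF⟩ hx)
    fun h => hxF ((P.mem_facet_iff ⟨F, hF⟩ hx).2 h)
  -- The height is a weighted mean of the values at `x` and `y`; the value at `x` is strictly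
  -- smaller, so the value at `y` must be larger.
  have h3 := h ⟨F, hF⟩
  rw [AffineMap.lineMap_apply_module', map_add, map_smul, map_sub, smul_eq_mul] at h1
  nlinarith

/-- A direction that violates no facet inequality at a point stays in the polytope for a while. -/
theorem exists_pos_add_smul_mem {v d : EuclideanSpace ℝ (Fin n)} (hv : v ∈ P.carrier)
    (hd : ∀ F : P.Facet, v ∈ F.1 → P.facetNormal F d ≤ 0) :
    ∃ ε : ℝ, 0 < ε ∧ v + ε • d ∈ P.carrier := by
  have hev : ∀ᶠ ε in nhdsWithin (0 : ℝ) (Set.Ioi 0),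
      ∀ F, P.facetNormal F (v + ε • d) ≤ P.facetHeight F := by
    rw [Filter.eventually_all]
    intro F
    by_cases hvF : v ∈ F.1
    · filter_upwards [self_mem_nhdsWithin] with ε hε
      rw [map_add, map_smul, smul_eq_mul]
      have h1 := P.facetNormal_le F hv
      have h2 : ε * P.facetNormal F d ≤ 0 := mul_nonpos_of_nonneg_of_nonpos (le_of_lt hε) (hd F hvF)
      linarith
    · have hlt := lt_of_le_of_ne (P.facetNormal_le F hv) fun h => hvF ((P.mem_facet_iff F hv).2 h)
      have hc : Continuous fun ε : ℝ => P.facetNormal F (v + ε • d) := by fun_prop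
      have := hc.continuousAt (x := 0)
      refine nhdsWithin_le_nhds ((this.eventually_lt_const (by simpa using hlt)).mono
        fun _ => le_of_lt)
  obtain ⟨ε, h1, h2⟩ := (hev.and self_mem_nhdsWithin).exists
  exact ⟨ε, h2, P.mem_of_forall_facetNormal_le h1⟩

/-! ### Vertices and their edge frames -/

theorem Vertex.mem {P : Polytope n} (v : P.Vertex) : v.1 ∈ P.carrier := v.2.1

/-- The facet normals at a vertex have no common zero. -/
theorem eq_zero_of_forall_facetNormal_eq_zero (v : P.Vertex) {d : EuclideanSpace ℝ (Fin n)}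
    (hd : ∀ F : P.Facet, v.1 ∈ F.1 → P.facetNormal F d = 0) : d = 0 := by
  obtain ⟨ε, hε, h1⟩ := P.exists_pos_add_smul_mem v.mem fun F hF => (hd F hF).le
  obtain ⟨δ, hδ, h2⟩ := P.exists_pos_add_smul_mem (d := -d) v.mem fun F hF => by
    rw [map_neg, hd F hF, neg_zero]
  have hmem : v.1 ∈ openSegment ℝ (v.1 + ε • d) (v.1 + δ • -d) := by
    have hne : ε + δ ≠ 0 := by positivity
    refine ⟨δ / (ε + δ), ε / (ε + δ), by positivity, by positivity, by field_simp; ring, ?_⟩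
    have h3 : δ / (ε + δ) + ε / (ε + δ) = 1 := by field_simp; ring
    have h4 : δ / (ε + δ) * ε = ε / (ε + δ) * δ := by ring
    calc _ = (δ / (ε + δ) + ε / (ε + δ)) • v.1
          + (δ / (ε + δ) * ε - ε / (ε + δ) * δ) • d := by module
      _ = v.1 := by rw [h3, h4, sub_self]; simp
  have h5 := ((mem_extremePoints.1 v.2).2 _ h1 _ h2 hmem).1
  simpa [hε.ne'] using h5

/-- At a vertex of a simple polytope the facets give a basis of normals and a dual frame of edge
directions. -/
theorem exists_frame (hs : P.IsSimple) (v : P.Vertex) :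
    ∃ F : Fin n → P.Facet, Function.Injective F ∧ (∀ G : P.Facet, v.1 ∈ G.1 ↔ ∃ i, F i = G) ∧
      ∃ d : Fin n → EuclideanSpace ℝ (Fin n),
        (∀ i j, P.facetNormal (F j) (d i) = if j = i then -1 else 0) ∧
        ∀ x, x - v.1 = ∑ i, (P.facetHeight (F i) - P.facetNormal (F i) x) • d i := by
  classical
  have hcard : Nat.card {F : P.Facet // v.1 ∈ F.1} = n := by
    refine Eq.trans ?_ (hs v)
    rw [← Nat.card_coe_set_eq]
    exact Nat.card_congr (Equiv.subtypeSubtypeEquivSubtypeInter (P.IsFace 1) (v.1 ∈ ·))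
  let e : Fin n ≃ {F : P.Facet // v.1 ∈ F.1} := (Finite.equivFinOfCardEq hcard).symm
  have hF : ∀ G : P.Facet, v.1 ∈ G.1 ↔ ∃ i, (e i).1 = G := fun G =>
    ⟨fun h => ⟨e.symm ⟨G, h⟩, by simp⟩, fun ⟨i, hi⟩ => hi ▸ (e i).2⟩
  let L : EuclideanSpace ℝ (Fin n) →ₗ[ℝ] (Fin n → ℝ) :=
    LinearMap.pi fun i => (P.facetNormal (e i).1 : EuclideanSpace ℝ (Fin n) →ₗ[ℝ] ℝ)
  have hL : Function.Injective L := by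
    rw [injective_iff_map_eq_zero]
    intro d hd
    refine P.eq_zero_of_forall_facetNormal_eq_zero v fun G hG => ?_
    obtain ⟨i, rfl⟩ := (hF G).1 hG
    exact congrFun hd i
  let L' := L.linearEquivOfInjective hL (by simp)
  have hL' : ∀ x, L' x = L x := fun x => rfl
  -- The minus sign makes `d i` point into the polytope: it leaves facet `i` and stays along the
  -- others.
  refine ⟨fun i => (e i).1, fun i j h => e.injective (Subtype.ext h), hF,
    fun i => -L'.symm (Pi.single i 1), fun i j => ?_, fun x => ?_⟩
  · have h1 : L (L'.symm (Pi.single i 1)) = Pi.single i 1 := L'.apply_symm_apply _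
    have h2 : P.facetNormal (e j).1 (L'.symm (Pi.single i 1)) =
        (Pi.single i 1 : Fin n → ℝ) j :=
      congrFun h1 j
    rw [map_neg, h2, Pi.single_apply]
    split_ifs <;> simp
  · apply hL
    funext j
    have h1 : ∀ i, L (L'.symm (Pi.single i 1)) = Pi.single i 1 := fun i => L'.apply_symm_apply _
    have hv : P.facetNormal (e j).1 v.1 = P.facetHeight (e j).1 :=
      (P.mem_facet_iff _ v.mem).1 (e j).2
    simp only [map_sum, map_smul, map_neg, h1]
    simp [L, hv, Pi.single_apply]

end Polytope

/-! ### Linear algebra of binary codes -/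

section Codes

variable {ι : Type*} [Fintype ι]

theorem mem_dualCode_span {S : Set (ι → ZMod 2)} {u : ι → ZMod 2} :
    u ∈ dualCode (Submodule.span (ZMod 2) S) ↔ ∀ c ∈ S, u ⬝ᵥ c = 0 := by
  refine ⟨fun h c hc => h c (Submodule.subset_span hc), fun h c hc => ?_⟩
  induction hc using Submodule.span_induction with
  | mem x hx => exact h x hx
  | zero => exact dotProduct_zero u
  | add x y _ _ hx hy => rw [dotProduct_add, hx, hy, add_zero]
  | smul a x _ hx => rw [dotProduct_smul, hx, smul_zero]

theorem finrank_dualCode (C : Submodule (ZMod 2) (ι → ZMod 2)) :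
    Module.finrank (ZMod 2) (dualCode C) = Fintype.card ι - Module.finrank (ZMod 2) C := by
  classical
  let B : LinearMap.BilinForm (ZMod 2) (ι → ZMod 2) := dotProductBilin (ZMod 2) (ZMod 2)
  have hB : B.Nondegenerate := by
    constructor
    · intro x hx
      exact dotProduct_eq_zero x hx
    · intro x hx
      exact dotProduct_eq_zero x fun y => (dotProduct_comm x y).trans (hx y)
  have h : dualCode C = B.orthogonal C := by
    ext u
    rw [LinearMap.BilinForm.mem_orthogonal_iff]
    exact forall₂_congr fun c _ => by
      rw [dotProduct_comm]; rfl
  rw [h, LinearMap.BilinForm.finrank_orthogonal hB, Module.finrank_fintype_fun_eq_card]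

/-- A code without nonzero words supported in `T` embeds in the coordinates outside `T`. -/
theorem finrank_le_card_compl (D : Submodule (ZMod 2) (ι → ZMod 2)) (T : Set ι)
    (h : ∀ u ∈ D, (∀ i ∉ T, u i = 0) → u = 0) :
    Module.finrank (ZMod 2) D ≤ Nat.card ↥Tᶜ := by
  classical
  let f : D →ₗ[ZMod 2] (↥Tᶜ → ZMod 2) :=
    (LinearMap.funLeft (ZMod 2) (ZMod 2) (Subtype.val : ↥Tᶜ → ι)).comp D.subtype
  have hf : Function.Injective f := by
    rw [injective_iff_map_eq_zero]
    intro u hu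
    exact Subtype.ext (h u.1 u.2 fun i hi => congrFun hu ⟨i, hi⟩)
  have := LinearMap.finrank_le_finrank_of_injective hf
  rwa [Module.finrank_fintype_fun_eq_card, ← Nat.card_eq_fintype_card] at this

/-- The two dimensions add up to the length, so an upper bound on the dual is a lower bound on `C`.
-/
theorem IsSelfDualCode.of_finrank {C : Submodule (ZMod 2) (ι → ZMod 2)} (hC : C ≤ dualCode C)
    (hdim : 2 * Module.finrank (ZMod 2) (dualCode C) ≤ Fintype.card ι) : IsSelfDualCode C := by
  refine Submodule.eq_of_le_of_finrank_le hC ?_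
  rw [finrank_dualCode] at *
  omega

theorem dotProduct_self_eq_hammingNorm (u : ι → ZMod 2) : u ⬝ᵥ u = (hammingNorm u : ZMod 2) := by
  have h : ∀ a : ZMod 2, a * a = if a ≠ 0 then 1 else 0 := by decide
  simp only [dotProduct, hammingNorm, h, Finset.sum_boole]

end Codes

/-! ### Vertex-facet incidences -/

namespace Polytope

open Classical

variable {n : ℕ} (P : Polytope n)

/-- The vertices of a polytope lying on a facet. -/
noncomputable def facetVertices (F : P.Facet) : Finset P.Vertex :=
  Finset.univ.filter fun v => v.1 ∈ F.1

@[simp]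
theorem mem_facetVertices {F : P.Facet} {v : P.Vertex} :
    v ∈ P.facetVertices F ↔ v.1 ∈ F.1 := by
  simp [facetVertices]

theorem dotProduct_faceVector (u : P.Vertex → ZMod 2) (F : P.Facet) :
    u ⬝ᵥ P.faceVector F.1 = ∑ v ∈ P.facetVertices F, u v := by
  simp [dotProduct, faceVector, Set.indicator_apply, facetVertices, Finset.sum_filter]

theorem faceVector_dotProduct_faceVector (F G : P.Facet) :
    P.faceVector F.1 ⬝ᵥ P.faceVector G.1 =
      ((P.facetVertices F ∩ P.facetVertices G).card : ZMod 2) := by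
  rw [dotProduct_faceVector, Finset.inter_comm, ← Finset.filter_mem_eq_inter]
  simp [faceVector, Set.indicator_apply]

theorem hammingNorm_faceVector (F : P.Facet) :
    hammingNorm (P.faceVector F.1) = (P.facetVertices F).card := by
  simp [hammingNorm, faceVector, Set.indicator_apply, facetVertices]

theorem mem_dualCode_faceCode {u : P.Vertex → ZMod 2} :
    u ∈ dualCode (P.faceCode 1) ↔ ∀ F : P.Facet, ∑ v ∈ P.facetVertices F, u v = 0 := by
  rw [faceCode, mem_dualCode_span]
  constructor
  · intro h F
    rw [← dotProduct_faceVector]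
    exact h _ ⟨F.1, F.2, rfl⟩
  · rintro h _ ⟨F, hF, rfl⟩
    exact (P.dotProduct_faceVector u ⟨F, hF⟩).trans (h ⟨F, hF⟩)

theorem faceVector_mem_faceCode (F : P.Facet) : P.faceVector F.1 ∈ P.faceCode 1 :=
  Submodule.subset_span ⟨F.1, F.2, rfl⟩

instance : Nonempty P.Vertex := by
  obtain ⟨x, hx⟩ := P.isCompact.extremePoints_nonempty P.nonempty
  exact ⟨⟨x, hx⟩⟩

theorem extremePoints_facet (F : P.Facet) :
    F.1.extremePoints ℝ = F.1 ∩ P.carrier.extremePoints ℝ :=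
  F.2.2.1.isExtreme.extremePoints_eq

theorem ncard_extremePoints_facet (F : P.Facet) :
    (F.1.extremePoints ℝ).ncard = (P.facetVertices F).card := by
  have h : F.1.extremePoints ℝ = Subtype.val '' (P.facetVertices F : Set P.Vertex) := by
    rw [extremePoints_facet]
    ext x
    constructor
    · rintro ⟨h1, h2⟩
      exact ⟨⟨x, h2⟩, P.mem_facetVertices.2 h1, rfl⟩
    · rintro ⟨v, hv, rfl⟩
      exact ⟨P.mem_facetVertices.1 hv, v.2⟩
  rw [h]
  exact (Set.ncard_image_of_injective _ Subtype.val_injective).trans (Set.ncard_coe_finset _)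

theorem facetVertices_nonempty (F : P.Facet) : (P.facetVertices F).Nonempty := by
  obtain ⟨x, hx⟩ := (F.2.2.1.isCompact P.isCompact).extremePoints_nonempty F.2.1
  rw [extremePoints_facet] at hx
  exact ⟨⟨x, hx.2⟩, P.mem_facetVertices.2 hx.1⟩

variable {P}

/-- A vertex is determined by the facets through it. -/
theorem Vertex.eq_of_forall_mem (v w : P.Vertex) (h : ∀ F : P.Facet, v.1 ∈ F.1 → w.1 ∈ F.1) :
    w = v := by
  have := P.eq_zero_of_forall_facetNormal_eq_zero v (d := w.1 - v.1) fun F hF => by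
    rw [map_sub, (P.mem_facet_iff F w.mem).1 (h F hF), (P.mem_facet_iff F v.mem).1 hF, sub_self]
  exact Subtype.ext (sub_eq_zero.1 this)

theorem IsSimple.card_facets (hs : P.IsSimple) (v : P.Vertex) :
    (Finset.univ.filter fun F : P.Facet => v.1 ∈ F.1).card = n := by
  obtain ⟨F, hF, hv, -⟩ := P.exists_frame hs v
  have : (Finset.univ.filter fun F : P.Facet => v.1 ∈ F.1) = Finset.univ.image F := by
    ext G; simp [hv]
  rw [this, Finset.card_image_of_injective _ hF, Finset.card_fin]

end Polytope

/-! ### Edges and parity in simple 3-polytopes -/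

namespace Polytope

open Classical

variable {P : Polytope 3}

/-- Two facets of a simple 3-polytope sharing a vertex share exactly one further vertex. -/
theorem IsSimple.exists_neighbor (hs : P.IsSimple) {F G : P.Facet} (hFG : F ≠ G) {v : P.Vertex}
    (hvF : v.1 ∈ F.1) (hvG : v.1 ∈ G.1) :
    ∃ w : P.Vertex, w ≠ v ∧ ∀ u : P.Vertex, (u.1 ∈ F.1 ∧ u.1 ∈ G.1) ↔ u = v ∨ u = w := by
  obtain ⟨N, hN, hv, d, hd, hexp⟩ := P.exists_frame hs v
  obtain ⟨i, rfl⟩ := (hv F).1 hvF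
  obtain ⟨j, rfl⟩ := (hv G).1 hvG
  have hij : i ≠ j := fun h => hFG (congrArg N h)
  obtain ⟨k, hki, hkj, hk⟩ : ∃ k : Fin 3, k ≠ i ∧ k ≠ j ∧ ∀ m, m ≠ k → m = i ∨ m = j := by
    clear * - hij; revert i j; decide
  set E := (N i).1 ∩ (N j).1
  have hEx : IsExtreme ℝ P.carrier E := (N i).2.2.1.isExtreme.inter (N j).2.2.1.isExtreme
  have hEP : E ⊆ P.carrier := hEx.subset
  have hEc : IsCompact E := ((N i).2.2.1.isCompact P.isCompact).inter
    ((N j).2.2.1.isCompact P.isCompact)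
  have hEconv : Convex ℝ E := ((N i).2.2.1.convex P.convex).inter ((N j).2.2.1.convex P.convex)
  have hdk : d k ≠ 0 := fun h => by simpa [h] using hd k k
  -- On both facets the frame coefficients other than the `k`-th vanish, so `E` lies on one ray from
  -- `v`.
  have hray : ∀ x ∈ E, ∃ t : ℝ, 0 ≤ t ∧ x = v.1 + t • d k := by
    intro x hx
    refine ⟨P.facetHeight (N k) - P.facetNormal (N k) x,
      sub_nonneg.2 (P.facetNormal_le _ (hEP hx)), ?_⟩
    rw [← sub_eq_iff_eq_add', hexp x]
    refine Finset.sum_eq_single k (fun m _ hm => ?_) (by simp)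
    have hxm : x ∈ (N m).1 := by
      rcases hk m hm with rfl | rfl
      exacts [hx.1, hx.2]
    rw [(P.mem_facet_iff _ (hEP hx)).1 hxm, sub_self, zero_smul]
  obtain ⟨ε, hε, hεP⟩ := P.exists_pos_add_smul_mem (d := d k) v.mem fun F hF => by
    obtain ⟨m, rfl⟩ := (hv F).1 hF
    rw [hd]
    split_ifs <;> norm_num
  have hεE : v.1 + ε • d k ∈ E := by
    constructor
    · rw [P.mem_facet_iff _ hεP, map_add, map_smul, hd, if_neg hki.symm, smul_zero, add_zero]
      exact (P.mem_facet_iff _ v.mem).1 hvF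
    · rw [P.mem_facet_iff _ hεP, map_add, map_smul, hd, if_neg hkj.symm, smul_zero, add_zero]
      exact (P.mem_facet_iff _ v.mem).1 hvG
  -- By Krein–Milman, `E` would otherwise be the single point `v`.
  obtain ⟨w, hwE, hwv⟩ : ∃ w : P.Vertex, w.1 ∈ E ∧ w ≠ v := by
    by_contra! hcon
    have hsub : E.extremePoints ℝ ⊆ {v.1} := fun x hx => by
      rw [hEx.extremePoints_eq] at hx
      exact congrArg Subtype.val (hcon ⟨x, hx.2⟩ hx.1)
    have h1 : E ⊆ {v.1} := by
      rw [← closure_convexHull_extremePoints hEc hEconv]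
      refine closure_minimal ?_ isClosed_singleton
      exact convexHull_min hsub (convex_singleton _)
    have h2 : v.1 + ε • d k = v.1 := h1 hεE
    rw [add_eq_left, smul_eq_zero] at h2
    exact h2.elim hε.ne' hdk
  have hbetween : ∀ (u w : P.Vertex) (s t : ℝ), 0 < s → s < t → u.1 = v.1 + s • d k →
      w.1 = v.1 + t • d k → False := by
    intro u w s t hs0 hst hu hw
    have ht : 0 < t := hs0.trans hst
    have hseg : u.1 ∈ openSegment ℝ v.1 w.1 := by
      refine ⟨1 - s / t, s / t, sub_pos.2 ((div_lt_one ht).2 hst), by positivity, by ring, ?_⟩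
      have h3 : s / t * t = s := div_mul_cancel₀ _ ht.ne'
      rw [hu, hw]
      calc _ = v.1 + (s / t * t) • d k := by module
        _ = _ := by rw [h3]
    have h2 := ((mem_extremePoints.1 u.2).2 _ v.mem _ w.mem hseg).1
    rw [hu, left_eq_add, smul_eq_zero] at h2
    exact h2.elim hs0.ne' hdk
  refine ⟨w, hwv, fun u => ⟨fun hu => ?_, ?_⟩⟩
  · obtain ⟨s, hs0, hsu⟩ := hray u.1 hu
    obtain ⟨t, ht0, htw⟩ := hray w.1 hwE
    rcases hs0.eq_or_lt with rfl | hs0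
    · exact Or.inl (Subtype.ext (by simpa using hsu))
    rcases ht0.eq_or_lt with rfl | ht0
    · exact absurd (Subtype.ext (by simpa using htw)) hwv
    rcases lt_trichotomy s t with h | rfl | h
    · exact (hbetween u w s t hs0 h hsu htw).elim
    · exact Or.inr (Subtype.ext (hsu.trans htw.symm))
    · exact (hbetween w u t s ht0 h htw hsu).elim
  · rintro (rfl | rfl)
    exacts [⟨hvF, hvG⟩, hwE]

theorem IsSimple.even_card_inter (hs : P.IsSimple) {F G : P.Facet} (hFG : F ≠ G) :
    Even (P.facetVertices F ∩ P.facetVertices G).card := by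
  rcases (P.facetVertices F ∩ P.facetVertices G).eq_empty_or_nonempty with h | ⟨v, hv⟩
  · simp [h]
  · simp only [Finset.mem_inter, mem_facetVertices] at hv
    obtain ⟨w, hwv, hw⟩ := hs.exists_neighbor hFG hv.1 hv.2
    have : P.facetVertices F ∩ P.facetVertices G = {v, w} := by
      ext u; simp [hw]
    rw [this, Finset.card_pair hwv.symm]
    exact even_two

theorem IsSimple.three_le_card (hs : P.IsSimple) (F : P.Facet) :
    3 ≤ (P.facetVertices F).card := by
  obtain ⟨v, hvF⟩ := P.facetVertices_nonempty F
  rw [mem_facetVertices] at hvF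
  obtain ⟨N, hN, hv, -⟩ := P.exists_frame hs v
  obtain ⟨i, rfl⟩ := (hv F).1 hvF
  obtain ⟨j, k, hij, hik, hm⟩ : ∃ j k : Fin 3, i ≠ j ∧ i ≠ k ∧ ∀ m, m = i ∨ m = j ∨ m = k := by
    clear * -; revert i; decide
  obtain ⟨w, hwv, hw⟩ := hs.exists_neighbor (hN.ne hij) hvF ((hv _).2 ⟨j, rfl⟩)
  obtain ⟨u, huv, hu⟩ := hs.exists_neighbor (hN.ne hik) hvF ((hv _).2 ⟨k, rfl⟩)
  have hwm := (hw w).2 (Or.inr rfl)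
  have hum := (hu u).2 (Or.inr rfl)
  -- A common neighbor along both edges would lie on all three facets at `v`.
  have hwu : w ≠ u := by
    rintro rfl
    refine hwv (Vertex.eq_of_forall_mem v w fun G hG => ?_)
    obtain ⟨m, rfl⟩ := (hv G).1 hG
    rcases hm m with rfl | rfl | rfl
    exacts [hwm.1, hwm.2, hum.2]
  have hcard : ({v, w, u} : Finset P.Vertex).card = 3 :=
    Finset.card_eq_three.2 ⟨v, w, u, hwv.symm, huv.symm, hwu, rfl⟩
  refine hcard.symm.le.trans ?_
  refine Finset.card_le_card fun x hx => ?_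
  simp only [Finset.mem_insert, Finset.mem_singleton] at hx
  rw [mem_facetVertices]
  rcases hx with rfl | rfl | rfl
  exacts [hvF, hwm.1, hum.1]

/-- Fix a color `a` other than that of `F`. The three facets at a vertex use all three colors, so
the facets of color `a` partition the vertices of `F` into even intersections. -/
theorem IsSimple.even_card (hs : P.IsSimple) (hcol : P.IsColorable 3) (F : P.Facet) :
    Even (P.facetVertices F).card := by
  obtain ⟨c, hc⟩ := hcol
  obtain ⟨a, ha⟩ : ∃ a, a ≠ c F := exists_ne _
  have hone : ∀ v : P.Vertex, (Finset.univ.filter fun G => c G = a ∧ v.1 ∈ G.1).card = 1 := by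
    intro v
    obtain ⟨N, hN, hv, -⟩ := P.exists_frame hs v
    have hmem : ∀ i, v.1 ∈ (N i).1 := fun i => (hv _).2 ⟨i, rfl⟩
    have hinj : Function.Injective fun i => c (N i) := fun i j h => by
      by_contra hij
      exact hc _ _ (hN.ne hij) ⟨v.1, hmem i, hmem j⟩ h
    obtain ⟨i, hi⟩ := Finite.surjective_of_injective hinj a
    rw [Finset.card_eq_one]
    refine ⟨N i, ?_⟩
    ext G
    simp only [Finset.mem_filter, Finset.mem_univ, true_and, Finset.mem_singleton]
    constructor
    · rintro ⟨hG, hvG⟩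
      obtain ⟨j, rfl⟩ := (hv G).1 hvG
      exact congrArg N (hinj (hG.trans hi.symm))
    · rintro rfl
      exact ⟨hi, hmem i⟩
  have hsum : (P.facetVertices F).card =
      ∑ G ∈ Finset.univ.filter (fun G => c G = a), (P.facetVertices F ∩ P.facetVertices G).card := by
    have := Finset.sum_card_bipartiteAbove_eq_sum_card_bipartiteBelow
      (s := P.facetVertices F) (t := Finset.univ.filter fun G => c G = a)
      (fun (v : P.Vertex) (G : P.Facet) => v.1 ∈ G.1)
    simp only [Finset.bipartiteAbove, Finset.bipartiteBelow, Finset.filter_filter, hone] at this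
    rw [Finset.sum_const, smul_eq_mul, mul_one] at this
    rw [this]
    refine Finset.sum_congr rfl fun G _ => congrArg _ ?_
    ext v; simp
  rw [hsum]
  refine Finset.even_sum _ fun G hG => hs.even_card_inter ?_
  rintro rfl
  exact ha (Finset.mem_filter.1 hG).2.symm

theorem IsSimple.faceCode_le_dualCode (hs : P.IsSimple) (hcol : P.IsColorable 3) :
    P.faceCode 1 ≤ dualCode (P.faceCode 1) := by
  refine Submodule.span_le.2 ?_
  rintro _ ⟨F, hF, rfl⟩
  rw [SetLike.mem_coe, mem_dualCode_faceCode]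
  intro G
  rw [← dotProduct_faceVector, P.faceVector_dotProduct_faceVector ⟨F, hF⟩ G,
    ZMod.natCast_eq_zero_iff_even]
  by_cases h : (⟨F, hF⟩ : P.Facet) = G
  · rw [h, Finset.inter_self]
    exact hs.even_card hcol G
  · exact hs.even_card_inter h

/-! ### Sweeping by a generic linear functional -/

/-- A vertex at which the functional `ℓ` attains its maximum over the facet `F`. -/
def IsTop (ℓ : Module.Dual ℝ (EuclideanSpace ℝ (Fin 3))) (F : P.Facet) (v : P.Vertex) : Prop :=
  v.1 ∈ F.1 ∧ ∀ u : P.Vertex, u.1 ∈ F.1 → ℓ u.1 ≤ ℓ v.1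

/-- Two of the three edge directions at `v` have slopes of the same weak sign. They span a facet,
which lies in their cone at `v`, so the local extremum is global on it. -/
theorem IsSimple.exists_isTop_or (hs : P.IsSimple)
    (ℓ : Module.Dual ℝ (EuclideanSpace ℝ (Fin 3))) (v : P.Vertex) :
    (∃ F, IsTop ℓ F v) ∨ ∃ F, IsTop (-ℓ) F v := by
  obtain ⟨N, hN, hv, d, hd, hexp⟩ := P.exists_frame hs v
  have key : ∀ (φ : Module.Dual ℝ (EuclideanSpace ℝ (Fin 3))) (k : Fin 3),
      (∀ i, i ≠ k → φ (d i) ≤ 0) → IsTop φ (N k) v := by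
    intro φ k hk
    refine ⟨(hv _).2 ⟨k, rfl⟩, fun u hu => sub_nonpos.1 ?_⟩
    rw [← map_sub, hexp, map_sum]
    refine Finset.sum_nonpos fun i _ => ?_
    rw [map_smul, smul_eq_mul]
    by_cases hik : i = k
    · rw [hik, (P.mem_facet_iff _ u.mem).1 hu, sub_self, zero_mul]
    · exact mul_nonpos_of_nonneg_of_nonpos (sub_nonneg.2 (P.facetNormal_le _ u.mem)) (hk i hik)
  have hsign : ∃ k : Fin 3, (∀ i, i ≠ k → ℓ (d i) ≤ 0) ∨ ∀ i, i ≠ k → (-ℓ) (d i) ≤ 0 := by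
    simp only [LinearMap.neg_apply, Left.neg_nonpos_iff, Fin.exists_fin_succ, Fin.forall_fin_succ]
    rcases le_total (ℓ (d 0)) 0 with h0 | h0 <;> rcases le_total (ℓ (d 1)) 0 with h1 | h1 <;>
      rcases le_total (ℓ (d 2)) 0 with h2 | h2 <;> simp [h0, h1, h2]
  obtain ⟨k, h | h⟩ := hsign
  · exact Or.inl ⟨_, key _ k h⟩
  · exact Or.inr ⟨_, key _ k h⟩

theorem exists_injective_functional {E ι : Type*} [AddCommGroup E] [Module ℝ E] [Finite ι]
    (p : ι → E) (hp : Function.Injective p) :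
    ∃ ℓ : Module.Dual ℝ E, Function.Injective fun i => ℓ (p i) := by
  obtain ⟨ℓ, -, hℓ⟩ := Module.Dual.exists_forall_mem_ne_zero_of_forall_exists
    (⊤ : Submodule ℝ (Module.Dual ℝ E))
    (fun ij : {ij : ι × ι // ij.1 ≠ ij.2} => Module.Dual.eval ℝ E (p ij.1.1 - p ij.1.2))
    (fun ij => by
      by_contra! h
      exact ij.2 (hp (sub_eq_zero.1
        ((Module.forall_dual_apply_eq_zero_iff ℝ _).1 fun φ => h φ trivial))))
  refine ⟨ℓ, fun i j hij => ?_⟩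
  by_contra hne
  refine hℓ ⟨(i, j), hne⟩ ?_
  simpa [sub_eq_zero] using hij

/-- If a dual word supported on tops were nonzero, its lowest support vertex would be the top of
some facet and the only support vertex there, violating that facet's parity check. -/
theorem finrank_dualCode_le_of_injective {ℓ : Module.Dual ℝ (EuclideanSpace ℝ (Fin 3))}
    (hℓ : Function.Injective fun v : P.Vertex => ℓ v.1) :
    Module.finrank (ZMod 2) (dualCode (P.faceCode 1)) ≤
      Nat.card ↥{v : P.Vertex | ∃ F, IsTop ℓ F v}ᶜ := by
  refine finrank_le_card_compl _ _ fun u hu hT => ?_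
  rw [mem_dualCode_faceCode] at hu
  by_contra hne
  obtain ⟨v₀, hv₀⟩ := Function.ne_iff.1 hne
  obtain ⟨v, hv, hmin⟩ := Finset.exists_min_image (Finset.univ.filter fun v => u v ≠ 0)
    (fun v => ℓ v.1) ⟨v₀, by simpa using hv₀⟩
  simp only [Finset.mem_filter, Finset.mem_univ, true_and] at hv hmin
  obtain ⟨F, hvF, hF⟩ : ∃ F, IsTop ℓ F v := by
    by_contra h
    exact hv (hT v h)
  have h1 := hu F
  rw [Finset.sum_eq_single v] at h1
  · exact hv h1
  · intro w hw hwv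
    by_contra hw0
    exact hwv (hℓ (le_antisymm (hF w (by simpa using hw)) (hmin w hw0)))
  · intro h
    exact absurd (by simpa using hvF) h

/-- Sending a facet to its top is onto the tops but not injective: the global maximum is the top of
three facets. -/
theorem IsSimple.card_tops_lt (hs : P.IsSimple) {ℓ : Module.Dual ℝ (EuclideanSpace ℝ (Fin 3))}
    (hℓ : Function.Injective fun v : P.Vertex => ℓ v.1) :
    Nat.card ↥{v : P.Vertex | ∃ F, IsTop ℓ F v} < Fintype.card P.Facet := by
  have hex : ∀ F : P.Facet, ∃ v, IsTop ℓ F v := fun F => by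
    obtain ⟨v, hv, hmax⟩ := Finset.exists_max_image (P.facetVertices F) (fun v => ℓ v.1)
      (P.facetVertices_nonempty F)
    exact ⟨v, by simpa using hv, fun u hu => hmax u (by simpa using hu)⟩
  choose f hf using hex
  have huniq : ∀ F v, IsTop ℓ F v → f F = v := fun F v h =>
    hℓ (le_antisymm (h.2 _ (hf F).1) ((hf F).2 _ h.1))
  rw [Nat.card_eq_fintype_card]
  refine Fintype.card_lt_of_surjective_not_injective
    (fun F => (⟨f F, F, hf F⟩ : ↥{v : P.Vertex | ∃ F, IsTop ℓ F v})) ?_ ?_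
  · rintro ⟨v, F, hF⟩
    exact ⟨F, Subtype.ext (huniq F v hF)⟩
  · intro hinj
    obtain ⟨v, hv⟩ := Finite.exists_max fun v : P.Vertex => ℓ v.1
    obtain ⟨N, hN, hNv, -⟩ := P.exists_frame hs v
    have htop : ∀ i, f (N i) = v := fun i =>
      huniq _ _ ⟨(hNv _).2 ⟨i, rfl⟩, fun u _ => hv u⟩
    have h01 : N 0 = N 1 := hinj (Subtype.ext ((htop 0).trans (htop 1).symm))
    exact absurd (hN h01) (by decide)

theorem IsSimple.card_vertex_le (hs : P.IsSimple)
    (ℓ : Module.Dual ℝ (EuclideanSpace ℝ (Fin 3))) :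
    Fintype.card P.Vertex ≤ Nat.card ↥{v : P.Vertex | ∃ F, IsTop ℓ F v} +
      Nat.card ↥{v : P.Vertex | ∃ F, IsTop (-ℓ) F v} := by
  rw [Nat.card_coe_set_eq, Nat.card_coe_set_eq, ← Nat.card_eq_fintype_card, ← Set.ncard_univ]
  refine le_trans (Set.ncard_le_ncard (fun v _ => ?_)) (Set.ncard_union_le _ _)
  exact hs.exists_isTop_or ℓ v

theorem IsSimple.card_vertex_lt (hs : P.IsSimple) :
    Fintype.card P.Vertex < 2 * Fintype.card P.Facet := by
  obtain ⟨ℓ, hℓ⟩ := exists_injective_functional (fun v : P.Vertex => v.1) Subtype.val_injective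
  have hℓ' : Function.Injective fun v : P.Vertex => (-ℓ) v.1 := fun v w h => hℓ (neg_injective h)
  have h1 := hs.card_vertex_le ℓ
  have h2 := hs.card_tops_lt hℓ
  have h3 := hs.card_tops_lt hℓ'
  omega

theorem IsSimple.isSelfDualCode_faceCode (hs : P.IsSimple) (hcol : P.IsColorable 3) :
    IsSelfDualCode (P.faceCode 1) := by
  refine IsSelfDualCode.of_finrank (hs.faceCode_le_dualCode hcol) ?_
  obtain ⟨ℓ, hℓ⟩ := exists_injective_functional (fun v : P.Vertex => v.1) Subtype.val_injective
  have hℓ' : Function.Injective fun v : P.Vertex => (-ℓ) v.1 := fun v w h => hℓ (neg_injective h)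
  have h1 := hs.card_vertex_le ℓ
  have h2 := finrank_dualCode_le_of_injective hℓ
  have h3 := finrank_dualCode_le_of_injective hℓ'
  have hcompl : ∀ T : Set P.Vertex, Nat.card ↥T + Nat.card ↥Tᶜ = Fintype.card P.Vertex := by
    intro T
    rw [Nat.card_coe_set_eq, Nat.card_coe_set_eq, Set.ncard_add_ncard_compl,
      Nat.card_eq_fintype_card]
  have h4 := hcompl {v | ∃ F, IsTop ℓ F v}
  have h5 := hcompl {v | ∃ F, IsTop (-ℓ) F v}
  omega

/-! ### Quadrilateral facets and minimum weight -/

theorem IsSimple.exists_card_eq_four (hs : P.IsSimple) (hcol : P.IsColorable 3) :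
    ∃ F : P.Facet, (P.facetVertices F).card = 4 := by
  by_contra! hne
  have h6 : ∀ F : P.Facet, 6 ≤ (P.facetVertices F).card := fun F => by
    have h3 := hs.three_le_card F
    have h4 := hne F
    obtain ⟨m, hm⟩ := hs.even_card hcol F
    omega
  -- Double counting of incidences: three facets per vertex.
  have hdc : ∑ F : P.Facet, (P.facetVertices F).card = Fintype.card P.Vertex * 3 := by
    have := Finset.sum_card_bipartiteAbove_eq_sum_card_bipartiteBelow
      (s := (Finset.univ : Finset P.Vertex)) (t := (Finset.univ : Finset P.Facet))
      (fun v F => v.1 ∈ F.1)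
    simp only [Finset.bipartiteAbove, Finset.bipartiteBelow, hs.card_facets] at this
    rw [Finset.sum_const, smul_eq_mul, Finset.card_univ] at this
    exact this.symm
  have hsum : Fintype.card P.Facet * 6 ≤ ∑ F : P.Facet, (P.facetVertices F).card := by
    rw [← smul_eq_mul, ← Finset.card_univ]
    exact Finset.card_nsmul_le_sum _ _ _ fun F _ => h6 F
  have := hs.card_vertex_lt
  omega

theorem IsSimple.four_le_hammingNorm (hs : P.IsSimple) (hcol : P.IsColorable 3)
    {u : P.Vertex → ZMod 2} (hu : u ∈ P.faceCode 1) (hu0 : u ≠ 0) : 4 ≤ hammingNorm u := by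
  have hdual := hs.faceCode_le_dualCode hcol hu
  have heven : Even (hammingNorm u) := by
    rw [← ZMod.natCast_eq_zero_iff_even, ← dotProduct_self_eq_hammingNorm]
    exact hdual u hu
  have hpos : 0 < hammingNorm u := hammingNorm_pos_iff.2 hu0
  have htwo : hammingNorm u ≠ 2 := by
    intro h
    obtain ⟨v, w, hvw, hsupp⟩ := Finset.card_eq_two.1 h
    have hv : u v ≠ 0 := by
      have : v ∈ Finset.univ.filter fun i => u i ≠ 0 := hsupp ▸ Finset.mem_insert_self _ _
      simpa using this
    have hrest : ∀ x, x ≠ v → x ≠ w → u x = 0 := fun x hxv hxw => by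
      by_contra hx
      have : x ∈ ({v, w} : Finset P.Vertex) := hsupp ▸ (by simpa using hx)
      simp [hxv, hxw] at this
    -- A facet containing `v` but not `w` would meet the support once, against orthogonality.
    refine hvw (Vertex.eq_of_forall_mem v w fun F hF => ?_).symm
    by_contra hwF
    have h1 := P.mem_dualCode_faceCode.1 hdual F
    rw [Finset.sum_eq_single v] at h1
    · exact hv h1
    · intro x hx hxv
      refine hrest x hxv ?_
      rintro rfl
      exact hwF (by simpa using hx)
    · intro hn
      exact absurd (by simpa using hF) hn
  obtain ⟨m, hm⟩ := heven
  omega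

end Polytope

theorem proposition7p1 (P : Polytope 3) (hsimple : P.IsSimple) (hcolor : P.IsColorable 3) :
    IsSelfDualCode (P.faceCode 1) ∧
    HasMinDist (P.faceCode 1) 4 ∧
    ∃ F : Set (EuclideanSpace ℝ (Fin 3)), P.IsFace 1 F ∧
      (Set.extremePoints ℝ F).ncard = 4 ∧ hammingNorm (P.faceVector F) = 4 := by
  obtain ⟨F, hF⟩ := hsimple.exists_card_eq_four hcolor
  have hnorm : hammingNorm (P.faceVector F.1) = 4 := (P.hammingNorm_faceVector F).trans hF
  refine ⟨hsimple.isSelfDualCode_faceCode hcolor, ⟨?_, ?_⟩, F.1, F.2,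
    (P.ncard_extremePoints_facet F).trans hF, hnorm⟩
  · refine ⟨_, P.faceVector_mem_faceCode F, 0, Submodule.zero_mem _, ?_, ?_⟩
    · intro h
      rw [h, hammingNorm_zero] at hnorm
      exact absurd hnorm (by norm_num)
    · rw [hammingDist_zero_right, hnorm]
  · rintro _ ⟨u, hu, v, hv, huv, rfl⟩
    rw [hammingDist_eq_hammingNorm]
    exact hsimple.four_le_hammingNorm hcolor
      (Submodule.add_mem _ (Submodule.neg_mem _ hu) hv)
      fun h => huv (neg_add_eq_zero.1 h)
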